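/- Let $d\ge 1$ and let $K_d$ be the complete metric graph on $d$ vertices, in which every edge has length $1$. A divisor on $K_d$ is a finite formal sum $D=\sum_{p\in K_d}D(p)\,(p)$ with $D(p)\in\mathbb Z$, and for $S\subseteq K_d$ we put $\deg(D|_S)=\sum_{p\in S}D(p)$. For a closed connected set $X\subseteq K_d$ and a boundary point $p\in\partial X$, let $\mathrm{outdeg}_X(p)$ be the maximum number of internally disjoint segments in $K_d\setminus X$ with an open end in $p$; the point $p$ is saturated with respect to $X$ and $D$ if $D(p)\ge \mathrm{outdeg}_X(p)$, and non-saturated otherwise. The divisor $D$ is reduced with respect to a point $q$ if $D(p)\ge 0$ for all $p\neq q$ and every non-empty closed connected set $X\subseteq K_d\setminus\{q\}$ has a non-saturated boundary point. Let $v$ be a vertex of $K_d$ and let $D$ be a divisor on $K_d$. Then $D$ is reduced with respect to $v$ if and only if the following three conditions hold: \begin{enumerate} \item $D(p)\ge 0$ for every point $p\in K_d\setminus\{v\}$; \item for every edge $e$ of $K_d$ with interior $e^\circ$, $\sum_{p\in e^\circ}D(p)\le 1$; \item there is an ordering $v_1,\dots,v_{d-1}$ of the vertices of $K_d$ other than $v$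 such that for every $1\le i\le d-1$ \[ \deg(D|_{A_i})\le i-1,\qquad\text{where } A_i=(v,v_i]\cup\bigcup_{j<i}(v_j,v_i], \] and $(u,w]$ denotes the edge joining $u$ and $w$, without the endpoint $u$ and with the endpoint $w$. \end{enumerate} -/

import Mathlib

noncomputable section

open Set unitInterval
open scoped NNReal

/-! ### The complete metric graph -/

/-- The points of the complete metric graph `K_d` with vertex set `Fin d`, in barycentric
coordinates: a point is a family of nonnegative weights on the vertices of total weight `1`
which is concentrated on the endpoints of a single edge. -/
def CompleteMetricGraph (d : ℕ) : Type :=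
  {x : Fin d → ℝ // x ∈ stdSimplex ℝ (Fin d) ∧ ∃ a b, Function.support x ⊆ {a, b}}

namespace CompleteMetricGraph

variable {d : ℕ}

/-- The vertices of `K_d`, seen as points. -/
def vertex (a : Fin d) : CompleteMetricGraph d :=
  ⟨Pi.single a 1, single_mem_stdSimplex ℝ a, a, a, fun c hc => by
    by_contra h
    exact hc (Pi.single_eq_of_ne (by simpa using h) _)⟩

/-- The edge of `K_d` joining `a` and `b`, parametrized by `[0, 1]` from `a` to `b`: the point at
distance `t` from `a` has weights `1 - t` at `a` and `t` at `b`. -/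
def edgePoint (a b : Fin d) (t : I) : CompleteMetricGraph d :=
  ⟨(1 - t : ℝ) • Pi.single a 1 + (t : ℝ) • Pi.single b 1,
    convex_stdSimplex ℝ (Fin d) (single_mem_stdSimplex ℝ a) (single_mem_stdSimplex ℝ b)
      (by linarith [t.2.2]) t.2.1 (by ring),
    a, b, fun c hc => by
      by_contra h
      simp only [mem_insert_iff, mem_singleton_iff, not_or] at h
      exact hc (by simp [h.1, h.2])⟩

/-- The open edge `(a, b)`. -/
def openEdge (a b : Fin d) : Set (CompleteMetricGraph d) := edgePoint a b '' Ioo 0 1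

/-- The half-open edge `(a, b]`. -/
def halfOpenEdge (a b : Fin d) : Set (CompleteMetricGraph d) := edgePoint a b '' Ioc 0 1

/-- The topology of `K_d`; it is the topology of the path metric below. -/
instance : TopologicalSpace (CompleteMetricGraph d) :=
  TopologicalSpace.induced Subtype.val inferInstance

open Classical in
/-- The length of the segment from `p` to `q` if the two points lie on a common edge (every edge
has length `1`). Otherwise the value is `2`, which is irrelevant for the path metric, since any
two points of `K_d` are joined by a path of length at most `2`. -/
def segmentLength (p q : CompleteMetricGraph d) : ℝ≥0 :=
  if ∃ a b, Function.support p.1 ⊆ {a, b} ∧ Function.support q.1 ⊆ {a, b} then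
    nndist p.1 q.1 else 2

theorem segmentLength_self (p : CompleteMetricGraph d) : segmentLength p p = 0 := by
  obtain ⟨a, b, h⟩ := p.2.2
  rw [segmentLength, if_pos ⟨a, b, h, h⟩, nndist_self]

theorem segmentLength_comm (p q : CompleteMetricGraph d) :
    segmentLength p q = segmentLength q p := by
  classical
  unfold segmentLength
  rw [nndist_comm]
  exact if_congr (by simp only [and_comm]) rfl rfl

/-- The path metric as a pseudometric: the distance of `p` and `q` is the infimum of the sums of
`segmentLength` along the finite chains from `p` to `q`. -/
abbrev pathPseudoMetric (d : ℕ) : PseudoMetricSpace (CompleteMetricGraph d) :=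
  PseudoMetricSpace.ofPreNNDist segmentLength segmentLength_self segmentLength_comm

/-- The length of a shortest path from `p` to `q`. -/
def pathDist (p q : CompleteMetricGraph d) : ℝ := (pathPseudoMetric d).dist p q

theorem pathDist_le (p q : CompleteMetricGraph d) : pathDist p q ≤ segmentLength p q :=
  PseudoMetricSpace.dist_ofPreNNDist_le _ segmentLength_self segmentLength_comm p q

theorem pathDist_triangle (p q r : CompleteMetricGraph d) :
    pathDist p r ≤ pathDist p q + pathDist q r :=
  (pathPseudoMetric d).dist_triangle p q r

theorem nndist_le_segmentLength (p q : CompleteMetricGraph d) :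
    nndist p.1 q.1 ≤ segmentLength p q := by
  unfold segmentLength
  split_ifs with h
  · exact le_rfl
  · rw [← NNReal.coe_le_coe, coe_nndist]
    refine (dist_pi_le_iff (by simp)).2 fun c => ?_
    have hp := mem_Icc_of_mem_stdSimplex p.2.1 c
    have hq := mem_Icc_of_mem_stdSimplex q.2.1 c
    rw [Real.dist_eq, abs_le]
    constructor <;> push_cast <;> linarith [hp.1, hp.2, hq.1, hq.2]

theorem dist_le_pathDist (p q : CompleteMetricGraph d) : dist p.1 q.1 ≤ pathDist p q := by
  have key : ∀ (l : List (CompleteMetricGraph d)) (p : CompleteMetricGraph d),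
      nndist p.1 q.1 ≤ ((p :: l).zipWith segmentLength (l ++ [q])).sum := by
    intro l
    induction l with
    | nil => intro p; simpa using nndist_le_segmentLength p q
    | cons r l ih =>
      intro p
      have h1 := nndist_triangle p.1 r.1 q.1
      have h2 : nndist p.1 r.1 + nndist r.1 q.1 ≤ segmentLength p r +
          ((r :: l).zipWith segmentLength (l ++ [q])).sum :=
        add_le_add (nndist_le_segmentLength p r) (ih r)
      simpa using h1.trans h2
  have : nndist p.1 q.1 ≤
      ⨅ l : List (CompleteMetricGraph d), ((p :: l).zipWith segmentLength (l ++ [q])).sum :=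
    le_ciInf fun l => key l p
  exact NNReal.coe_le_coe.2 this

theorem pathDist_of_common {p q : CompleteMetricGraph d} {a b : Fin d}
    (hp : Function.support p.1 ⊆ {a, b}) (hq : Function.support q.1 ⊆ {a, b}) :
    pathDist p q = dist p.1 q.1 := by
  refine le_antisymm ?_ (dist_le_pathDist p q)
  have := pathDist_le p q
  rwa [segmentLength, if_pos ⟨a, b, hp, hq⟩, coe_nndist] at this

theorem add_eq_one {p : CompleteMetricGraph d} {a b : Fin d} (hab : a ≠ b)
    (hp : Function.support p.1 ⊆ {a, b}) : p.1 a + p.1 b = 1 := by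
  rw [← p.2.1.2, ← Finset.sum_pair hab]
  refine Finset.sum_subset (Finset.subset_univ _) fun c _ hc => ?_
  by_contra h
  exact hc (by simpa using hp h)

theorem exists_support (p : CompleteMetricGraph d) :
    ∃ a b, Function.support p.1 ⊆ {a, b} ∧ 1 / 2 ≤ p.1 a := by
  obtain ⟨a, b, h⟩ := p.2.2
  by_cases hab : a = b
  · refine ⟨a, b, h, ?_⟩
    have : p.1 a = 1 := by
      rw [← p.2.1.2]
      refine (Finset.sum_eq_single a (fun c _ hc => ?_) (by simp)).symm
      by_contra h'
      have := h h'
      simp_all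
    rw [this]; norm_num
  · have h1 := add_eq_one hab h
    rcases le_total (1 / 2) (p.1 a) with h2 | h2
    · exact ⟨a, b, h, h2⟩
    · exact ⟨b, a, by rwa [pair_comm], by linarith⟩

theorem support_vertex (a b : Fin d) : Function.support (vertex a).1 ⊆ {a, b} := by
  intro c hc
  by_contra h
  simp only [mem_insert_iff, mem_singleton_iff, not_or] at h
  exact hc (Pi.single_eq_of_ne h.1 _)

theorem pathDist_vertex {p : CompleteMetricGraph d} {a b : Fin d} (hab : a ≠ b)
    (hp : Function.support p.1 ⊆ {a, b}) : pathDist p (vertex a) ≤ p.1 b := by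
  rw [pathDist_of_common hp (support_vertex a b), dist_pi_le_iff (p.2.1.1 b)]
  intro c
  have h1 := add_eq_one hab hp
  have h0 := p.2.1.1 b
  by_cases hca : c = a
  · subst hca
    simp only [vertex, Pi.single_eq_same, Real.dist_eq]
    rw [abs_le]; constructor <;> linarith
  · have hv : (vertex a).1 c = 0 := Pi.single_eq_of_ne hca _
    rw [hv, Real.dist_eq, sub_zero, abs_of_nonneg (p.2.1.1 c)]
    by_cases hcb : c = b
    · rw [hcb]
    · have : p.1 c = 0 := by
        by_contra h
        have := hp h
        simp_all
      rw [this]; exact h0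

theorem pathDist_le_two_mul {p q : CompleteMetricGraph d} (h : dist p.1 q.1 < 1 / 2) :
    pathDist p q ≤ 2 * dist p.1 q.1 := by
  obtain ⟨a, b, hp, ha⟩ := exists_support p
  have hd : ∀ c, |p.1 c - q.1 c| ≤ dist p.1 q.1 := fun c => dist_le_pi_dist p.1 q.1 c
  have hqa : q.1 a ≠ 0 := by
    have := (abs_le.1 (hd a)).2
    intro h0
    linarith
  obtain ⟨c, hq⟩ : ∃ c, Function.support q.1 ⊆ {a, c} := by
    obtain ⟨x, y, hxy⟩ := q.2.2
    have := hxy (show a ∈ Function.support q.1 from hqa)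
    rcases this with rfl | h'
    · exact ⟨y, hxy⟩
    · rw [mem_singleton_iff] at h'
      subst h'
      exact ⟨x, by rwa [pair_comm]⟩
  have h0 : 0 ≤ dist p.1 q.1 := dist_nonneg
  by_cases hbc : c = b ∨ b = a ∨ c = a
  · have : pathDist p q = dist p.1 q.1 := by
      rcases hbc with rfl | rfl | rfl
      · exact pathDist_of_common hp hq
      · exact pathDist_of_common (hp.trans (by simp)) hq
      · exact pathDist_of_common hp (hq.trans (by simp))
    linarith
  · simp only [not_or] at hbc
    obtain ⟨hcb, hba, hca⟩ := hbc
    have hqb : q.1 b = 0 := by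
      by_contra h'
      have := hq h'
      simp_all
    have hpc : p.1 c = 0 := by
      by_contra h'
      have := hp h'
      simp_all
    have h1 := pathDist_vertex (Ne.symm hba) hp
    have h2 := pathDist_vertex (Ne.symm hca) hq
    have h3 := pathDist_triangle p (vertex a) q
    have h4 : pathDist (vertex a) q = pathDist q (vertex a) :=
      (pathPseudoMetric d).dist_comm _ _
    have h5 := (abs_le.1 (hd b)).2
    have h6 := (abs_le.1 (hd c)).1
    linarith

/-- `K_d` with the path metric, all edges having length `1`. -/
instance : MetricSpace (CompleteMetricGraph d) :=
  MetricSpace.ofDistTopology pathDist (pathPseudoMetric d).dist_self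
    (pathPseudoMetric d).dist_comm (pathPseudoMetric d).dist_triangle
    (fun s => by
      constructor
      · rintro ⟨t, ht, rfl⟩ x hx
        obtain ⟨ε, hε, h⟩ := Metric.isOpen_iff.1 ht x.1 hx
        refine ⟨ε, hε, fun y hy => h ?_⟩
        rw [Metric.mem_ball, dist_comm]
        exact (dist_le_pathDist x y).trans_lt hy
      · intro h
        let _ : PseudoMetricSpace (CompleteMetricGraph d) :=
          PseudoMetricSpace.induced Subtype.val inferInstance
        refine Metric.isOpen_iff.2 fun x hx => ?_
        obtain ⟨ε, hε, h⟩ := h x hx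
        refine ⟨min (1 / 2) (ε / 2), by positivity, fun y hy => h y ?_⟩
        have hy' : dist x.1 y.1 < min (1 / 2) (ε / 2) := by
          rw [dist_comm]; exact hy
        have h1 := pathDist_le_two_mul (hy'.trans_le (min_le_left _ _))
        have h2 := hy'.trans_le (min_le_right _ _)
        linarith)
    (fun p q h => Subtype.ext (dist_le_zero.1 ((dist_le_pathDist p q).trans_eq h)))

/-- Every edge is an isometric copy of the unit interval. -/
theorem isometry_edgePoint {a b : Fin d} (hab : a ≠ b) : Isometry (edgePoint a b) := by
  refine Isometry.of_dist_eq fun s t => ?_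
  have hs : ∀ t, Function.support (edgePoint a b t).1 ⊆ {a, b} := fun t c hc => by
    by_contra h
    simp only [mem_insert_iff, mem_singleton_iff, not_or] at h
    exact hc (by simp [edgePoint, h.1, h.2])
  change pathDist _ _ = _
  rw [pathDist_of_common (hs s) (hs t)]
  refine le_antisymm ((dist_pi_le_iff dist_nonneg).2 fun c => ?_) ?_
  · rw [Subtype.dist_eq, Real.dist_eq, Real.dist_eq]
    by_cases hca : c = a
    · subst hca
      simp [edgePoint, hab, abs_sub_comm]
    · by_cases hcb : c = b
      · subst hcb
        simp [edgePoint, hca]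
      · simp [edgePoint, hca, hcb]
  · have := dist_le_pi_dist (edgePoint a b s).1 (edgePoint a b t).1 b
    simpa [edgePoint, hab.symm, Subtype.dist_eq] using this

/-- For an ordering `ord` of the vertices other than `v`, the set
`A_i = (v, ord i] ∪ ⋃ j < i, (ord j, ord i]`. -/
def orderedStar (v : Fin d) (ord : Fin (d - 1) ≃ {w : Fin d // w ≠ v}) (i : Fin (d - 1)) :
    Set (CompleteMetricGraph d) :=
  halfOpenEdge v (ord i) ∪ ⋃ j, ⋃ (_ : j < i), halfOpenEdge (ord j) (ord i)

end CompleteMetricGraph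

/-! ### Divisors and reduced divisors on a metric graph -/

namespace MetricGraph

/-- The group of divisors: the free abelian group on the points. -/
abbrev Divisor (Γ : Type*) : Type _ := Γ →₀ ℤ

open Classical in
/-- The degree of the restriction of the divisor `D` to `S`. -/
def degOn {Γ : Type*} (D : Divisor Γ) (S : Set Γ) : ℤ := ∑ p ∈ D.support with p ∈ S, D p

variable {Γ : Type*} [TopologicalSpace Γ]

/-- `γ` parametrizes a segment contained in `Γ ∖ X`, apart from its end at `p`, which is open. -/
structure IsOutgoingSegment (X : Set Γ) (p : Γ) (γ : I → Γ) : Prop where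
  continuous : Continuous γ
  injective : Function.Injective γ
  source : γ 0 = p
  notMem : ∀ t ∈ Ioc (0 : I) 1, γ t ∉ X

/-- The outgoing degree of `X` at `p`: the maximal number of internally disjoint segments in
`Γ ∖ X` with an open end in `p`. -/
def outdeg (X : Set Γ) (p : Γ) : ℕ :=
  sSup {n : ℕ | ∃ γ : Fin n → I → Γ, (∀ i, IsOutgoingSegment X p (γ i)) ∧
    Pairwise fun i j => Disjoint (γ i '' Ioo 0 1) (γ j '' Ioo 0 1)}

/-- `p` is saturated with respect to `X` and `D` (used for boundary points `p` of `X`). -/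
def IsSaturated (X : Set Γ) (D : Divisor Γ) (p : Γ) : Prop := (outdeg X p : ℤ) ≤ D p

/-- `D` is effective away from `p`, and every (nonempty) closed connected set `X` not containing
`p` has a boundary point that is not saturated. -/
def IsReduced (D : Divisor Γ) (p : Γ) : Prop :=
  (∀ q, q ≠ p → 0 ≤ D q) ∧
    ∀ X : Set Γ, IsClosed X → IsConnected X → p ∉ X → ∃ q ∈ frontier X, ¬ IsSaturated X D q

end MetricGraph

end

/-! The proof is Dhar's burning argument. For a set `B` of vertices containing `v` and a vertex `u`
outside `B`, the star of `u` over `B` is the union of the half-open edges `(b, u]`, `b ∈ B`.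

Conditions imply reduced: suppose that a closed nonempty `X` avoiding `v` has a saturated boundary.
If `X` contains a vertex, let `u` be the first one in the ordering, and let `B` consist of `v` and
the earlier vertices. Along each edge from `u` to `B` the set `X` must stop, either at `u`, which
adds one to the outgoing degree there, or at an interior point, which needs a chip. So the star
carries at least `|B|` chips (`card_le_degOn_star`), against condition 3. If `X` contains no vertex,
its two extreme points on an edge need two chips in the interior (`exists_two_le_degOn_openEdge`),
against condition 2.

Reduced implies conditions: two chips inside an edge bound a saturated segment, whence condition 2.
For condition 3, the fire burning `B` spreads to any `u` whose star has fewer than `|B|` chips. If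
there were none, the unburnt vertices, all edges between them, and their edges towards `B` cut off
at a chip (or at once, if chipless) would form a closed connected set with saturated boundary
(`not_isReduced_of_unburnt`). Hence the fire spreads, and the order of burning is the required
ordering.

Outgoing degrees are computed with arms, the open segments leaving a point: `outdeg_le` bounds them
above, `card_le_outdeg` below. -/

noncomputable section

open Set unitInterval

namespace MetricGraph

/-! ### Degrees of restricted divisors -/

variable {Γ : Type*}

theorem degOn_union (D : Divisor Γ) {S T : Set Γ} (h : Disjoint S T) :
    degOn D (S ∪ T) = degOn D S + degOn D T := by
  classical
  unfold degOn
  rw [← Finset.sum_union]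
  · congr 1
    ext p
    simp only [Finset.mem_union, Finset.mem_filter, mem_union]
    tauto
  · rw [Finset.disjoint_left]
    intro p hp hq
    simp only [Finset.mem_filter] at hp hq
    exact Set.disjoint_left.1 h hp.2 hq.2

theorem degOn_empty (D : Divisor Γ) : degOn D ∅ = 0 := by
  simp [degOn]

theorem degOn_singleton (D : Divisor Γ) (p : Γ) : degOn D {p} = D p := by
  classical
  unfold degOn
  by_cases h : D p = 0
  · rw [h]
    refine Finset.sum_eq_zero fun q hq => ?_
    simp only [Finset.mem_filter, mem_singleton_iff] at hq
    rw [hq.2, h]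
  · rw [← Finset.sum_singleton D p]
    congr 1
    ext q
    simp only [Finset.mem_filter, Finsupp.mem_support_iff, mem_singleton_iff,
      Finset.mem_singleton]
    constructor
    · exact fun hq => hq.2
    · rintro rfl
      exact ⟨h, rfl⟩

theorem degOn_biUnion {ι : Type*} (D : Divisor Γ) (s : Finset ι) (S : ι → Set Γ)
    (h : (s : Set ι).PairwiseDisjoint S) :
    degOn D (⋃ i ∈ s, S i) = ∑ i ∈ s, degOn D (S i) := by
  classical
  induction s using Finset.induction_on with
  | empty => simp [degOn_empty]
  | insert a s ha ih =>
    rw [Finset.set_biUnion_insert, degOn_union, Finset.sum_insert ha, ih]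
    · exact h.subset (by simp)
    · refine disjoint_iUnion₂_right.2 fun i hi => h (by simp) (by simp [hi]) ?_
      rintro rfl
      exact ha hi

theorem degOn_nonneg {D : Divisor Γ} {S : Set Γ} (h : ∀ p ∈ S, 0 ≤ D p) : 0 ≤ degOn D S :=
  Finset.sum_nonneg fun p hp => h p (by classical exact (Finset.mem_filter.1 hp).2)

theorem degOn_mono {D : Divisor Γ} {S T : Set Γ} (hST : S ⊆ T) (h : ∀ p ∈ T, 0 ≤ D p) :
    degOn D S ≤ degOn D T := by
  rw [← union_sdiff_cancel hST, degOn_union D disjoint_sdiff_right]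
  have := degOn_nonneg (D := D) (S := T \ S) fun p hp => h p hp.1
  linarith

theorem exists_pos_of_degOn_pos {D : Divisor Γ} {S : Set Γ} (h : 0 < degOn D S) :
    ∃ p ∈ S, 0 < D p := by
  classical
  by_contra! hS
  exact absurd h (not_lt.2 (Finset.sum_nonpos fun p hp => hS p (Finset.mem_filter.1 hp).2))

/-! ### Outgoing segments on disjoint arms -/

variable [TopologicalSpace Γ]

theorem IsOutgoingSegment.mem_frontier {X : Set Γ} {p : Γ} {γ : I → Γ}
    (h : IsOutgoingSegment X p γ) (hp : p ∈ X) : p ∈ frontier X := by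
  refine ⟨subset_closure hp, fun hi => ?_⟩
  have h1 : γ ⁻¹' X ∈ nhds (0 : I) :=
    h.continuous.continuousAt.preimage_mem_nhds (by
      rw [h.source]
      exact mem_interior_iff_mem_nhds.1 hi)
  have : (nhdsWithin (0 : I) (Ioi 0)).NeBot := nhdsGT_neBot_of_exists_gt ⟨1, zero_lt_one⟩
  have h2 : (γ ⁻¹' X ∩ Ioi (0 : I)).Nonempty :=
    Filter.nonempty_of_mem (Filter.inter_mem (mem_nhdsWithin_of_mem_nhds h1) self_mem_nhdsWithin)
  obtain ⟨t, ht, ht0⟩ := h2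
  exact h.notMem t ⟨ht0, le_top⟩ ht

/-- If the points near `p` outside `X` lie on finitely many disjoint open arms at `p`, each
carrying an injective coordinate that vanishes at `p`, then internally disjoint segments leaving
`X` at `p` start on different arms. -/
theorem card_outgoing_le {κ : Type*} {X : Set Γ} {p : Γ} (T : Finset κ)
    (V : κ → Set Γ) (φ : κ → Γ → ℝ) (hV : ∀ k ∈ T, IsOpen (V k))
    (hd : (T : Set κ).PairwiseDisjoint V) (hφ : ∀ k ∈ T, Continuous (φ k))
    (hpos : ∀ k ∈ T, ∀ x ∈ V k, 0 < φ k x) (hp : ∀ k ∈ T, φ k p = 0)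
    (hinj : ∀ k ∈ T, InjOn (φ k) (V k)) {N : Set Γ} (hN : N ∈ nhds p)
    (hNX : ∀ x ∈ N, x ∉ X → x ≠ p → ∃ k ∈ T, x ∈ V k)
    {n : ℕ} (γ : Fin n → I → Γ) (hγ : ∀ i, IsOutgoingSegment X p (γ i))
    (hγd : Pairwise fun i j => Disjoint (γ i '' Ioo 0 1) (γ j '' Ioo 0 1)) :
    n ≤ T.card := by
  classical
  -- A short initial piece of each segment, without `p`, is connected and covered by the disjoint
  -- open arms, so it stays in one of them.
  have hstart : ∀ i, ∃ k ∈ T, ∃ δ : I, 0 < δ ∧ δ < 1 ∧ ∀ t ∈ Ioc 0 δ, γ i t ∈ V k := by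
    intro i
    have h1 : γ i ⁻¹' N ∈ nhds (0 : I) :=
      (hγ i).continuous.continuousAt.preimage_mem_nhds (by rwa [(hγ i).source])
    have h2 : {x : I | x < 1} ∈ nhds (0 : I) := isOpen_Iio.mem_nhds (by simp)
    obtain ⟨ε, hε, hεN⟩ := (mem_nhdsGE_iff_exists_Ico_subset' zero_lt_one).1
      (mem_nhdsWithin_of_mem_nhds (t := Ici (0 : I)) (Filter.inter_mem h1 h2))
    obtain ⟨δ, hδ0, hδε⟩ := exists_between (show (0 : I) < ε from hε)
    have hδN := (Icc_subset_Ico_right hδε).trans hεN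
    have hmem : ∀ t ∈ Ioc 0 δ, ∃ k ∈ T, γ i t ∈ V k := fun t ht =>
      hNX _ (hδN ⟨ht.1.le, ht.2⟩).1 ((hγ i).notMem t ⟨ht.1, le_top⟩) fun h =>
        ht.1.ne' ((hγ i).injective (h.trans (hγ i).source.symm))
    obtain ⟨k, hk, hkδ⟩ := hmem δ ⟨hδ0, le_rfl⟩
    refine ⟨k, hk, δ, hδ0, (hδN ⟨hδ0.le, le_rfl⟩).2, ?_⟩
    have hconn : IsPreconnected (γ i '' Ioc 0 δ) :=
      isPreconnected_Ioc.image _ (hγ i).continuous.continuousOn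
    have hsub := IsPreconnected.subset_left_of_subset_union (hV k hk)
      (isOpen_biUnion fun j (hj : j ∈ T.erase k) => hV j (Finset.mem_of_mem_erase hj))
      (disjoint_iUnion₂_right.2 fun j hj => hd hk (Finset.mem_of_mem_erase hj)
        (Finset.ne_of_mem_erase hj).symm) ?_
      ⟨γ i δ, mem_image_of_mem (γ i) (show δ ∈ Ioc 0 δ from ⟨hδ0, le_rfl⟩), hkδ⟩ hconn
    · exact fun t ht => hsub (mem_image_of_mem _ ht)
    · rintro _ ⟨t, ht, rfl⟩
      obtain ⟨j, hj, hjt⟩ := hmem t ht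
      by_cases hjk : j = k
      · exact Or.inl (hjk ▸ hjt)
      · exact Or.inr (mem_biUnion (Finset.mem_erase.2 ⟨hjk, hj⟩) hjt)
  choose k hkT δ hδ0 hδ1 hkV using hstart
  -- By the intermediate value theorem, two segments starting on one arm both attain every small
  -- coordinate `s`, hence meet there; `δ < 1` makes the meeting point interior to both.
  have hk : Function.Injective k := by
    intro i j hij
    by_contra hne
    have hfill : ∀ i, ∀ s ∈ Ioc 0 (φ (k i) (γ i (δ i))), ∃ t ∈ Ioc 0 (δ i), φ (k i) (γ i t) = s := by
      intro i s hs
      have hc : ContinuousOn (fun t => φ (k i) (γ i t)) (Icc 0 (δ i)) :=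
        ((hφ _ (hkT i)).comp (hγ i).continuous).continuousOn
      have h0 : φ (k i) (γ i 0) = 0 := by rw [(hγ i).source, hp _ (hkT i)]
      have := intermediate_value_Ioc (hδ0 i).le hc
      rw [h0] at this
      exact this hs
    set s := min (φ (k i) (γ i (δ i))) (φ (k j) (γ j (δ j)))
    have hs : 0 < s := lt_min (hpos _ (hkT i) _ (hkV i _ ⟨hδ0 i, le_rfl⟩))
      (hpos _ (hkT j) _ (hkV j _ ⟨hδ0 j, le_rfl⟩))
    obtain ⟨t, ht, hts⟩ := hfill i s ⟨hs, min_le_left _ _⟩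
    obtain ⟨t', ht', hts'⟩ := hfill j s ⟨hs, min_le_right _ _⟩
    have heq : γ i t = γ j t' := by
      refine hinj _ (hkT i) (hkV i t ht) (by rw [hij]; exact hkV j t' ht') ?_
      rw [hts, hij, hts']
    refine Set.disjoint_left.1 (hγd hne) (mem_image_of_mem _ ⟨ht.1, ht.2.trans_lt (hδ1 i)⟩) ?_
    rw [heq]
    exact mem_image_of_mem _ ⟨ht'.1, ht'.2.trans_lt (hδ1 j)⟩
  calc n = (Finset.univ : Finset (Fin n)).card := by simp
    _ = (Finset.univ.image k).card := (Finset.card_image_of_injective _ hk).symm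
    _ ≤ T.card := Finset.card_le_card fun x hx => by
      obtain ⟨i, _, rfl⟩ := Finset.mem_image.1 hx
      exact hkT i

end MetricGraph

/-! ### Greedy orderings of a finite type -/

/-- Appending a new element to a partial list does not change the set of predecessors of the earlier
entries, so their property persists. -/
theorem exists_greedy_equiv {α : Type*} [Fintype α] [DecidableEq α] {n : ℕ}
    (hn : Fintype.card α = n) (P : Finset α → α → Prop)
    (h : ∀ B : Finset α, B ≠ Finset.univ → ∃ u, u ∉ B ∧ P B u) :
    ∃ ord : Fin n ≃ α, ∀ i, P ((Finset.univ.filter (· < i)).image ord) (ord i) := by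
  have key : ∀ k ≤ n, ∃ f : Fin k → α, Function.Injective f ∧
      ∀ i, P ((Finset.univ.filter (· < i)).image f) (f i) := by
    intro k
    induction k with
    | zero => exact fun _ => ⟨Fin.elim0, fun i => i.elim0, fun i => i.elim0⟩
    | succ k ih =>
      intro hk
      obtain ⟨f, hf, hP⟩ := ih (by omega)
      obtain ⟨u, hu, hPu⟩ := h (Finset.univ.image f) fun h' => by
        have := congrArg Finset.card h'
        rw [Finset.card_image_of_injective _ hf, Finset.card_univ, Finset.card_univ, hn,
          Fintype.card_fin] at this
        omega
      refine ⟨Fin.snoc f u, Fin.snoc_injective_iff.2 ⟨hf, by simpa using hu⟩, fun i => ?_⟩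
      induction i using Fin.lastCases with
      | last =>
        rw [Fin.snoc_last]
        convert hPu using 1
        ext x
        simp only [Finset.mem_image, Finset.mem_filter, Finset.mem_univ, true_and]
        constructor
        · rintro ⟨i, hi, rfl⟩
          obtain ⟨j, rfl⟩ := Fin.exists_castSucc_eq.2 hi.ne
          exact ⟨j, by simp⟩
        · rintro ⟨j, rfl⟩
          exact ⟨j.castSucc, Fin.castSucc_lt_last j, by simp⟩
      | cast i =>
        rw [Fin.snoc_castSucc]
        convert hP i using 1
        ext x
        simp only [Finset.mem_image, Finset.mem_filter, Finset.mem_univ, true_and]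
        constructor
        · rintro ⟨j, hj, rfl⟩
          obtain ⟨l, rfl⟩ := Fin.exists_castSucc_eq.2 (hj.trans (Fin.castSucc_lt_last i)).ne
          exact ⟨l, by simpa using hj, by simp⟩
        · rintro ⟨j, hj, rfl⟩
          exact ⟨j.castSucc, by simpa using hj, by simp⟩
  obtain ⟨f, hf, hP⟩ := key n le_rfl
  have hb : Function.Bijective f :=
    (Fintype.bijective_iff_injective_and_card f).2 ⟨hf, by simp [hn]⟩
  exact ⟨Equiv.ofBijective f hb, hP⟩

namespace CompleteMetricGraph

open MetricGraph

variable {d : ℕ}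

/-! ### Coordinates, edges and stars -/

theorem coord_nonneg (p : CompleteMetricGraph d) (a : Fin d) : 0 ≤ p.1 a := p.2.1.1 a

theorem continuous_coord (a : Fin d) : Continuous fun p : CompleteMetricGraph d => p.1 a := by
  refine LipschitzWith.continuous (K := 1) (LipschitzWith.of_dist_le_mul fun p q => ?_)
  rw [NNReal.coe_one, one_mul]
  exact (dist_le_pi_dist p.1 q.1 a).trans (dist_le_pathDist p q)

/-- The closed edge joining `a` and `b`. -/
def closedEdge (a b : Fin d) : Set (CompleteMetricGraph d) :=
  {p | Function.support p.1 ⊆ {a, b}}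

theorem coord_eq_zero {p : CompleteMetricGraph d} {a b c : Fin d} (hp : p ∈ closedEdge a b)
    (ha : c ≠ a) (hb : c ≠ b) : p.1 c = 0 := by
  by_contra h
  rcases hp h with h | h
  · exact ha h
  · exact hb h

theorem closedEdge_comm (a b : Fin d) : closedEdge a b = closedEdge b a := by
  unfold closedEdge
  rw [pair_comm]

theorem exists_mem_closedEdge {p : CompleteMetricGraph d} {a : Fin d} (ha : 0 < p.1 a) :
    ∃ b, p ∈ closedEdge a b := by
  obtain ⟨x, y, hxy⟩ := p.2.2
  rcases hxy (show a ∈ Function.support p.1 from ha.ne') with rfl | h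
  · exact ⟨y, hxy⟩
  · rw [mem_singleton_iff] at h
    subst h
    exact ⟨x, by rwa [closedEdge_comm]⟩

theorem mem_closedEdge_of_pos {p : CompleteMetricGraph d} {a b : Fin d} (hab : a ≠ b)
    (ha : 0 < p.1 a) (hb : 0 < p.1 b) : p ∈ closedEdge a b := by
  obtain ⟨c, hc⟩ := exists_mem_closedEdge ha
  rcases hc (show b ∈ Function.support p.1 from hb.ne') with h | h
  · exact absurd h.symm hab
  · rw [mem_singleton_iff] at h
    rwa [h]

theorem closedEdge_ext {p q : CompleteMetricGraph d} {a b : Fin d} (hab : a ≠ b)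
    (hp : p ∈ closedEdge a b) (hq : q ∈ closedEdge a b) (h : p.1 b = q.1 b) : p = q := by
  have h1 := add_eq_one hab hp
  have h2 := add_eq_one hab hq
  refine Subtype.ext (funext fun c => ?_)
  by_cases hca : c = a
  · subst hca; linarith
  by_cases hcb : c = b
  · rw [hcb, h]
  rw [coord_eq_zero hp hca hcb, coord_eq_zero hq hca hcb]

theorem vertex_mem_closedEdge (a b : Fin d) : vertex a ∈ closedEdge a b := support_vertex a b

@[simp] theorem vertex_coord_self (a : Fin d) : (vertex a).1 a = 1 := Pi.single_eq_same a 1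

theorem vertex_coord_of_ne {a c : Fin d} (h : c ≠ a) : (vertex a).1 c = 0 :=
  Pi.single_eq_of_ne h _

theorem eq_vertex {p : CompleteMetricGraph d} {a b : Fin d} (hab : a ≠ b)
    (hp : p ∈ closedEdge a b) (h : p.1 b = 0) : p = vertex a :=
  closedEdge_ext hab hp (vertex_mem_closedEdge a b) (by rw [h, vertex_coord_of_ne hab.symm])

theorem edgePoint_mem_closedEdge (a b : Fin d) (t : I) : edgePoint a b t ∈ closedEdge a b := by
  intro c hc
  by_contra h
  simp only [mem_insert_iff, mem_singleton_iff, not_or] at h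
  exact hc (by simp [edgePoint, h.1, h.2])

theorem edgePoint_coord_right {a b : Fin d} (hab : a ≠ b) (t : I) :
    (edgePoint a b t).1 b = t := by
  simp [edgePoint, hab.symm]

theorem edgePoint_coord_left {a b : Fin d} (hab : a ≠ b) (t : I) :
    (edgePoint a b t).1 a = 1 - t := by
  simp [edgePoint, hab]

theorem continuous_edgePoint (a b : Fin d) : Continuous (edgePoint a b) := by
  by_cases hab : a = b
  · subst hab
    have : edgePoint a a = fun _ => vertex a := by
      funext t
      refine Subtype.ext ?_
      simp [edgePoint, vertex, ← add_smul]
    rw [this]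
    exact continuous_const
  · exact (isometry_edgePoint hab).continuous

/-- The coordinate of a point as an element of the unit interval. -/
def coordI (p : CompleteMetricGraph d) (a : Fin d) : I := ⟨p.1 a, mem_Icc_of_mem_stdSimplex p.2.1 a⟩

theorem edgePoint_coordI {p : CompleteMetricGraph d} {a b : Fin d} (hab : a ≠ b)
    (hp : p ∈ closedEdge a b) : edgePoint a b (coordI p b) = p :=
  closedEdge_ext hab (edgePoint_mem_closedEdge a b _) hp (edgePoint_coord_right hab _)

theorem mem_openEdge {p : CompleteMetricGraph d} {a b : Fin d} (hab : a ≠ b) :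
    p ∈ openEdge a b ↔ 0 < p.1 a ∧ 0 < p.1 b := by
  constructor
  · rintro ⟨t, ht, rfl⟩
    rw [edgePoint_coord_left hab, edgePoint_coord_right hab]
    exact ⟨sub_pos.2 ht.2, ht.1⟩
  · rintro ⟨ha, hb⟩
    have hp := mem_closedEdge_of_pos hab ha hb
    refine ⟨coordI p b, ⟨hb, ?_⟩, edgePoint_coordI hab hp⟩
    have := add_eq_one hab hp
    change p.1 b < 1
    linarith

theorem halfOpenEdge_eq (a b : Fin d) :
    halfOpenEdge a b = {vertex b} ∪ openEdge a b := by
  have h1 : edgePoint a b 1 = vertex b := Subtype.ext (by simp [edgePoint, vertex])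
  rw [halfOpenEdge, openEdge, ← h1, ← image_singleton, ← image_union]
  congr 1
  ext t
  simp only [mem_Ioc, mem_union, mem_singleton_iff, mem_Ioo]
  constructor
  · rintro ⟨h, h'⟩
    exact (eq_or_lt_of_le h').imp_right fun h'' => ⟨h, h''⟩
  · rintro (rfl | h)
    · exact ⟨by simp, le_rfl⟩
    · exact ⟨h.1, h.2.le⟩

/-- The half-open edges all share their endpoint `u`, so its chips are counted once; `B` must be
nonempty for `u` to occur at all. -/
theorem degOn_star (D : Divisor (CompleteMetricGraph d)) {u : Fin d} {B : Finset (Fin d)}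
    (hB : B.Nonempty) (hu : u ∉ B) :
    degOn D (⋃ b ∈ B, halfOpenEdge b u) = D (vertex u) + ∑ b ∈ B, degOn D (openEdge b u) := by
  have hne : ∀ b ∈ B, b ≠ u := fun b hb h => hu (h ▸ hb)
  have h1 : (⋃ b ∈ B, halfOpenEdge b u) = {vertex u} ∪ ⋃ b ∈ B, openEdge b u := by
    rw [← biUnion_const (s := (B : Set (Fin d))) hB {vertex u}]
    simp only [Finset.mem_coe, ← iUnion_union_distrib]
    exact iUnion₂_congr fun b _ => halfOpenEdge_eq b u
  rw [h1, degOn_union, degOn_singleton, degOn_biUnion]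
  · intro b hb b' hb' hbb'
    rw [Function.onFun, Set.disjoint_left]
    intro p hp hp'
    rw [mem_openEdge (hne b hb)] at hp
    rw [mem_openEdge (hne b' hb')] at hp'
    have := coord_eq_zero (mem_closedEdge_of_pos (hne b hb) hp.1 hp.2) hbb'.symm (hne b' hb')
    linarith [hp'.1]
  · rw [disjoint_singleton_left, mem_iUnion₂]
    rintro ⟨b, hb, h⟩
    rw [mem_openEdge (hne b hb), vertex_coord_of_ne (hne b hb)] at h
    exact lt_irrefl _ h.1

/-! ### Directions, arms and outgoing degrees -/

/-- The pair `e` stands for the direction at `p` along the edge from `e.1` to `e.2`, towards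
`e.2`. -/
structure IsDirection (p : CompleteMetricGraph d) (e : Fin d × Fin d) : Prop where
  ne : e.1 ≠ e.2
  pos : 0 < p.1 e.1
  mem : p ∈ closedEdge e.1 e.2

/-- The open segment starting at `p` in the direction `e`. -/
def arm (p : CompleteMetricGraph d) (e : Fin d × Fin d) : Set (CompleteMetricGraph d) :=
  {z | 0 < z.1 e.1 ∧ p.1 e.2 < z.1 e.2}

theorem isOpen_arm (p : CompleteMetricGraph d) (e : Fin d × Fin d) : IsOpen (arm p e) :=
  (isOpen_lt continuous_const (continuous_coord _)).inter
    (isOpen_lt continuous_const (continuous_coord _))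

theorem arm_subset {p : CompleteMetricGraph d} {e : Fin d × Fin d} (he : e.1 ≠ e.2) :
    arm p e ⊆ closedEdge e.1 e.2 := fun _ hz =>
  mem_closedEdge_of_pos he hz.1 ((coord_nonneg p _).trans_lt hz.2)

/-- A common point puts both directions on one edge. Distinct ones are then opposite, and both
coordinates would exceed those of `p`, although each pair sums to 1. -/
theorem disjoint_arm {p : CompleteMetricGraph d} {e f : Fin d × Fin d} (he : IsDirection p e)
    (hf : IsDirection p f) (hef : e ≠ f) : Disjoint (arm p e) (arm p f) := by
  rw [Set.disjoint_left]
  intro z hz hz'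
  have hs := arm_subset he.ne hz
  have h1 := hs (show f.1 ∈ Function.support z.1 from hz'.1.ne')
  have h2 := hs (show f.2 ∈ Function.support z.1 from
    ((coord_nonneg p _).trans_lt hz'.2).ne')
  obtain ⟨a, b⟩ := e
  obtain ⟨a', b'⟩ := f
  have hne := hf.ne
  have h3 := add_eq_one he.ne hs
  have h4 := add_eq_one he.ne he.mem
  have h5 := hz.2
  have h6 := hz'.2
  simp only [mem_insert_iff, mem_singleton_iff] at *
  rcases h1 with rfl | rfl <;> rcases h2 with rfl | rfl
  · exact hne rfl
  · exact hef rfl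
  · linarith
  · exact hne rfl

theorem card_outgoing_le_card_arms {X : Set (CompleteMetricGraph d)} {p : CompleteMetricGraph d}
    (T : Finset (Fin d × Fin d)) (hT : ∀ e ∈ T, IsDirection p e)
    {N : Set (CompleteMetricGraph d)} (hN : N ∈ nhds p)
    (hNX : ∀ x ∈ N, x ∉ X → x ≠ p → ∃ e ∈ T, x ∈ arm p e)
    {n : ℕ} (γ : Fin n → I → CompleteMetricGraph d) (hγ : ∀ i, IsOutgoingSegment X p (γ i))
    (hγd : Pairwise fun i j => Disjoint (γ i '' Ioo 0 1) (γ j '' Ioo 0 1)) :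
    n ≤ T.card :=
  card_outgoing_le T (arm p) (fun e z => z.1 e.2 - p.1 e.2) (fun e _ => isOpen_arm p e)
    (fun _ he _ hf hef => disjoint_arm (hT _ he) (hT _ hf) hef)
    (fun e _ => (continuous_coord e.2).sub continuous_const)
    (fun _ _ _ hx => sub_pos.2 hx.2) (fun _ _ => sub_self _)
    (fun e he x hx y hy h => closedEdge_ext (hT e he).ne (arm_subset (hT e he).ne hx)
      (arm_subset (hT e he).ne hy) (by simpa using h)) hN hNX γ hγ hγd

theorem outdeg_le {X : Set (CompleteMetricGraph d)} {p : CompleteMetricGraph d}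
    (T : Finset (Fin d × Fin d)) (hT : ∀ e ∈ T, IsDirection p e)
    {N : Set (CompleteMetricGraph d)} (hN : N ∈ nhds p)
    (hNX : ∀ x ∈ N, x ∉ X → x ≠ p → ∃ e ∈ T, x ∈ arm p e) : outdeg X p ≤ T.card := by
  refine csSup_le' ?_
  rintro n ⟨γ, hγ, hγd⟩
  exact card_outgoing_le_card_arms T hT hN hNX γ hγ hγd

theorem support_nhds (p : CompleteMetricGraph d) :
    {z : CompleteMetricGraph d | ∀ a, 0 < p.1 a → 0 < z.1 a} ∈ nhds p := by
  have : {z : CompleteMetricGraph d | ∀ a, 0 < p.1 a → 0 < z.1 a} =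
      ⋂ a, {z | 0 < p.1 a → 0 < z.1 a} := by
    ext; simp
  rw [this, Filter.iInter_mem]
  intro a
  by_cases h : 0 < p.1 a
  · simp only [h, true_imp_iff]
    exact (isOpen_lt continuous_const (continuous_coord a)).mem_nhds h
  · simp [h]

theorem exists_pos (p : CompleteMetricGraph d) : ∃ a, 0 < p.1 a := by
  obtain ⟨a, _, _, h⟩ := exists_support p
  exact ⟨a, by linarith⟩

/-- An edge through `z` also contains `p`, since the support of `p` lies in that of `z`; comparing
coordinates gives the direction. -/
theorem exists_direction {p z : CompleteMetricGraph d} (hz : ∀ a, 0 < p.1 a → 0 < z.1 a)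
    (hzp : z ≠ p) : ∃ e, IsDirection p e ∧ z ∈ arm p e := by
  obtain ⟨a, ha⟩ := exists_pos p
  obtain ⟨b, hb⟩ := exists_mem_closedEdge (hz a ha)
  have hpm : p ∈ closedEdge a b := fun c hc =>
    hb (hz c ((coord_nonneg p c).lt_of_ne' hc)).ne'
  by_cases hab : a = b
  · subst hab
    exfalso
    have key : ∀ q ∈ closedEdge a a, q.1 = (vertex a).1 := by
      intro q hq
      have h0 : ∀ c, c ≠ a → q.1 c = 0 := fun c hc => coord_eq_zero hq hc hc
      have h1 : q.1 a = 1 := by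
        rw [← q.2.1.2]
        exact (Finset.sum_eq_single a (fun c _ hc => h0 c hc) (by simp)).symm
      funext c
      by_cases hc : c = a
      · rw [hc, h1, vertex_coord_self]
      · rw [h0 c hc, vertex_coord_of_ne hc]
    exact hzp (Subtype.ext ((key z hb).trans (key p hpm).symm))
  · have h1 := add_eq_one hab hb
    have h2 := add_eq_one hab hpm
    rcases lt_trichotomy (p.1 b) (z.1 b) with h | h | h
    · exact ⟨(a, b), ⟨hab, ha, hpm⟩, hz a ha, h⟩
    · exact absurd (closedEdge_ext hab hb hpm h.symm) hzp
    · have hz0 := coord_nonneg z b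
      have hpb : 0 < p.1 b := by linarith
      refine ⟨(b, a), ⟨Ne.symm hab, hpb, ?_⟩, hz b hpb, ?_⟩
      · rwa [closedEdge_comm]
      · change p.1 a < z.1 a
        linarith

/-- The set of all points strictly beyond `p` in the direction `e`, endpoint included, avoids
`X`. -/
def IsFree (X : Set (CompleteMetricGraph d)) (p : CompleteMetricGraph d) (e : Fin d × Fin d) :
    Prop :=
  ∀ z ∈ closedEdge e.1 e.2, p.1 e.2 < z.1 e.2 → z ∉ X

/-- The segment from `p` to the end of its edge in the direction `e`. -/
def ray (p : CompleteMetricGraph d) (e : Fin d × Fin d) (t : I) : CompleteMetricGraph d :=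
  edgePoint e.1 e.2 (σ (σ t * σ (coordI p e.2)))

/-- As `σ x = 1 - x`, the parameter in `ray` is `1 - (1 - t) (1 - p.1 e.2)`, the affine path from
`p.1 e.2` to 1 written with operations of the unit interval. -/
theorem ray_coord {p : CompleteMetricGraph d} {e : Fin d × Fin d} (he : e.1 ≠ e.2) (t : I) :
    (ray p e t).1 e.2 = p.1 e.2 + t * (1 - p.1 e.2) := by
  rw [ray, edgePoint_coord_right he]
  simp only [coe_symm_eq, Icc.coe_mul, coordI]
  ring

theorem isOutgoingSegment_ray {X : Set (CompleteMetricGraph d)} {p : CompleteMetricGraph d}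
    {e : Fin d × Fin d} (he : IsDirection p e) (hX : IsFree X p e) :
    IsOutgoingSegment X p (ray p e) := by
  have h1 := add_eq_one he.ne he.mem
  have hlt : 0 < 1 - p.1 e.2 := by linarith [he.pos]
  refine ⟨?_, ?_, ?_, ?_⟩
  · unfold ray
    exact (continuous_edgePoint _ _).comp (by fun_prop)
  · intro s t hst
    have h2 := ray_coord (p := p) he.ne s
    rw [hst, ray_coord he.ne] at h2
    exact Subtype.ext (mul_right_cancel₀ hlt.ne' (by linarith))
  · exact closedEdge_ext he.ne (edgePoint_mem_closedEdge _ _ _) he.mem (by simp [ray_coord he.ne])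
  · intro t ht
    refine hX _ (edgePoint_mem_closedEdge _ _ _) ?_
    have : 0 < (t : ℝ) * (1 - p.1 e.2) := mul_pos ht.1 hlt
    rw [ray_coord he.ne]
    linarith

theorem ray_mem_arm {p : CompleteMetricGraph d} {e : Fin d × Fin d} (he : IsDirection p e)
    {t : I} (ht : t ∈ Ioo (0 : I) 1) : ray p e t ∈ arm p e := by
  have h1 := add_eq_one he.ne he.mem
  have hlt : 0 < 1 - p.1 e.2 := by linarith [he.pos]
  have h2 := add_eq_one he.ne (edgePoint_mem_closedEdge e.1 e.2 (σ (σ t * σ (coordI p e.2))))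
  change (ray p e t).1 e.1 + (ray p e t).1 e.2 = 1 at h2
  have h3 := ray_coord (p := p) he.ne t
  have h4 : 0 < (t : ℝ) * (1 - p.1 e.2) := mul_pos ht.1 hlt
  have ht1 : (t : ℝ) < 1 := ht.2
  have h5 : 0 < (1 - (t : ℝ)) * (1 - p.1 e.2) := mul_pos (by linarith) hlt
  exact ⟨by linarith, by linarith⟩

theorem card_le_outdeg {X : Set (CompleteMetricGraph d)} {p : CompleteMetricGraph d}
    (T : Finset (Fin d × Fin d)) (hT : ∀ e ∈ T, IsDirection p e ∧ IsFree X p e) :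
    T.card ≤ outdeg X p := by
  classical
  -- The number of all directions at `p` bounds the family counts; without a bound the supremum in
  -- `ℕ` would be the default value 0.
  refine le_csSup ⟨(Finset.univ.filter fun e => IsDirection p e).card, ?_⟩ ?_
  · rintro n ⟨γ, hγ, hγd⟩
    refine card_outgoing_le_card_arms _ (fun e he => (Finset.mem_filter.1 he).2)
      (support_nhds p) (fun x hx _ hxp => ?_) γ hγ hγd
    obtain ⟨e, he, hxe⟩ := exists_direction hx hxp
    exact ⟨e, by simpa using he, hxe⟩
  · refine ⟨fun i => ray p (T.equivFin.symm i), fun i => ?_, fun i j hij => ?_⟩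
    · have := hT _ (T.equivFin.symm i).2
      exact isOutgoingSegment_ray this.1 this.2
    · have hi := hT _ (T.equivFin.symm i).2
      have hj := hT _ (T.equivFin.symm j).2
      refine (disjoint_arm hi.1 hj.1 fun h => hij ?_).mono ?_ ?_
      · exact T.equivFin.symm.injective (Subtype.ext h)
      · rintro _ ⟨t, ht, rfl⟩
        exact ray_mem_arm hi.1 ht
      · rintro _ ⟨t, ht, rfl⟩
        exact ray_mem_arm hj.1 ht

/-! ### Saturated boundaries force chips -/

/-- Saturation is assumed only on the frontier; a free direction, which exists as `T` is nonempty,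
places `p` there. -/
theorem card_le_of_saturated {X : Set (CompleteMetricGraph d)}
    {D : Divisor (CompleteMetricGraph d)} (hX : ∀ q ∈ frontier X, IsSaturated X D q)
    {p : CompleteMetricGraph d} (hp : p ∈ X) {T : Finset (Fin d × Fin d)} (hne : T.Nonempty)
    (hT : ∀ e ∈ T, IsDirection p e ∧ IsFree X p e) : (T.card : ℤ) ≤ D p := by
  obtain ⟨e, he⟩ := hne
  have h1 := hX p ((isOutgoingSegment_ray (hT e he).1 (hT e he).2).mem_frontier hp)
  exact (Int.ofNat_le.2 (card_le_outdeg T hT)).trans h1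

/-- By compactness, `X` has a last point on the edge in the direction of `b`. -/
theorem exists_isFree {X : Set (CompleteMetricGraph d)} (hX : IsClosed X) {a b : Fin d}
    (hab : a ≠ b) {z : CompleteMetricGraph d} (hz : z ∈ X) (hze : z ∈ closedEdge a b) :
    ∃ p ∈ X, p ∈ closedEdge a b ∧ IsFree X p (a, b) := by
  have hc : IsCompact (edgePoint a b ⁻¹' X) := (hX.preimage (continuous_edgePoint a b)).isCompact
  obtain ⟨t, ht, hmax⟩ := hc.exists_isMaxOn
    ⟨coordI z b, by rw [mem_preimage, edgePoint_coordI hab hze]; exact hz⟩ continuous_id.continuousOn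
  refine ⟨edgePoint a b t, ht, edgePoint_mem_closedEdge a b t, fun x hx hlt hxX => ?_⟩
  have := hmax (show coordI x b ∈ _ by rw [mem_preimage, edgePoint_coordI hab hx]; exact hxX)
  rw [edgePoint_coord_right hab] at hlt
  exact absurd hlt (not_lt.2 this)

theorem ne_vertex_of_mem_openEdge {p : CompleteMetricGraph d} {a b : Fin d} (hab : a ≠ b)
    (hp : p ∈ openEdge a b) (c : Fin d) : p ≠ vertex c := by
  rintro rfl
  rw [mem_openEdge hab] at hp
  by_cases hac : a = c
  · subst hac
    rw [vertex_coord_of_ne hab.symm] at hp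
    exact lt_irrefl _ hp.2
  · rw [vertex_coord_of_ne hac] at hp
    exact lt_irrefl _ hp.1

/-- A closed set with saturated boundary that contains the vertex `u`, but no vertex of `B`, forces
at least one chip on the star of `u` per vertex of `B`. -/
theorem card_le_degOn_star {X : Set (CompleteMetricGraph d)}
    {D : Divisor (CompleteMetricGraph d)} (hX : IsClosed X)
    (hsat : ∀ q ∈ frontier X, IsSaturated X D q) {u : Fin d} {B : Finset (Fin d)}
    (hB : B.Nonempty) (hu : vertex u ∈ X) (hBX : ∀ b ∈ B, vertex b ∉ X)
    (hDu : 0 ≤ D (vertex u)) (hD : ∀ b ∈ B, ∀ p ∈ openEdge b u, 0 ≤ D p) :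
    (B.card : ℤ) ≤ degOn D (⋃ b ∈ B, halfOpenEdge b u) := by
  classical
  have huB : u ∉ B := fun h => hBX u h hu
  have hne : ∀ b ∈ B, u ≠ b := fun b hb h => huB (h ▸ hb)
  rw [degOn_star D hB huB]
  set S := B.filter fun b => IsFree X (vertex u) (u, b) with hS
  have h1 : (S.card : ℤ) ≤ D (vertex u) := by
    rcases S.eq_empty_or_nonempty with h | h
    · simpa [h] using hDu
    · have h2 : ((S.image fun b => (u, b)).card : ℤ) ≤ D (vertex u) := by
        refine card_le_of_saturated hsat hu (h.image _) fun e he => ?_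
        obtain ⟨b, hb, rfl⟩ := Finset.mem_image.1 he
        rw [hS, Finset.mem_filter] at hb
        exact ⟨⟨hne b hb.1, by simp, vertex_mem_closedEdge u b⟩, hb.2⟩
      rwa [Finset.card_image_of_injective _ (Prod.mk_right_injective u)] at h2
  -- Each `b` accounts for one chip: if the direction from `u` to `b` is free it is counted in `S`,
  -- otherwise the last point of `X` on the edge is interior and carries a chip.
  have h2 : ∀ b ∈ B, (1 : ℤ) - (if IsFree X (vertex u) (u, b) then 1 else 0) ≤
      degOn D (openEdge b u) := by
    intro b hb
    split_ifs with hfree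
    · simpa using degOn_nonneg (hD b hb)
    · obtain ⟨p, hpX, hpe, hpf⟩ := exists_isFree hX (hne b hb) hu (vertex_mem_closedEdge u b)
      have hsum := add_eq_one (hne b hb) hpe
      have hpu : 0 < p.1 u := by
        refine (coord_nonneg p u).lt_of_ne' fun h => hBX b hb ?_
        rwa [← eq_vertex (hne b hb).symm (by rwa [closedEdge_comm]) h]
      have hpb : 0 < p.1 b := by
        refine (coord_nonneg p b).lt_of_ne' fun h => hfree ?_
        rwa [← eq_vertex (hne b hb) hpe h]
      have hpo : p ∈ openEdge b u := (mem_openEdge (hne b hb).symm).2 ⟨hpb, hpu⟩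
      have h3 := card_le_of_saturated hsat hpX (T := {(u, b)}) (by simp) fun e he => by
        rw [Finset.mem_singleton.1 he]
        exact ⟨⟨hne b hb, hpu, hpe⟩, hpf⟩
      have h4 := degOn_mono (D := D) (singleton_subset_iff.2 hpo) (hD b hb)
      rw [degOn_singleton] at h4
      simp only [Finset.card_singleton, Nat.cast_one] at h3
      linarith
  have h3 := Finset.sum_le_sum h2
  rw [Finset.sum_sub_distrib, Finset.sum_boole, ← hS] at h3
  simp only [Finset.sum_const, nsmul_eq_mul, mul_one] at h3
  linarith

/-- A nonempty closed set with saturated boundary and without vertices meets an edge whose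
interior carries at least two chips. -/
theorem exists_two_le_degOn_openEdge {X : Set (CompleteMetricGraph d)}
    {D : Divisor (CompleteMetricGraph d)} (hX : IsClosed X) (hXne : X.Nonempty)
    (hsat : ∀ q ∈ frontier X, IsSaturated X D q) (hXv : ∀ a, vertex a ∉ X)
    (hD : ∀ a b, a ≠ b → ∀ p ∈ openEdge a b, 0 ≤ D p) :
    ∃ a b, a ≠ b ∧ 2 ≤ degOn D (openEdge a b) := by
  classical
  obtain ⟨z, hz⟩ := hXne
  obtain ⟨a, ha⟩ := exists_pos z
  have hza : z ≠ vertex a := fun h => hXv a (h ▸ hz)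
  -- Comparing `z` with the vertex `a` yields an edge through `z` with distinct ends.
  obtain ⟨⟨a', b⟩, he, hzb⟩ := exists_direction (p := vertex a) (z := z) (fun c hc => by
    by_cases hca : c = a
    · rwa [hca]
    · rw [vertex_coord_of_ne hca] at hc
      exact absurd hc (lt_irrefl _)) hza
  obtain rfl : a' = a := by
    by_contra h
    have := he.pos
    rw [vertex_coord_of_ne h] at this
    exact lt_irrefl _ this
  have hab : a' ≠ b := he.ne
  have hze : z ∈ closedEdge a' b := arm_subset he.ne hzb
  have hopen : ∀ p ∈ X, p ∈ closedEdge a' b → p ∈ openEdge a' b := by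
    intro p hp hpe
    refine (mem_openEdge hab).2 ⟨(coord_nonneg p _).lt_of_ne' fun h => ?_,
      (coord_nonneg p _).lt_of_ne' fun h => ?_⟩
    · exact hXv b (eq_vertex hab.symm (by rwa [closedEdge_comm]) h ▸ hp)
    · exact hXv a' (eq_vertex hab hpe h ▸ hp)
  refine ⟨a', b, hab, ?_⟩
  obtain ⟨p, hpX, hpe, hpf⟩ := exists_isFree hX hab hz hze
  obtain ⟨q, hqX, hqe, hqf⟩ := exists_isFree hX hab.symm hz (by rwa [closedEdge_comm])
  rw [closedEdge_comm] at hqe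
  have hpo := hopen p hpX hpe
  have hqo := hopen q hqX hqe
  have hp := (mem_openEdge hab).1 hpo
  have hq := (mem_openEdge hab).1 hqo
  have hpd : IsDirection p (a', b) := ⟨hab, hp.1, hpe⟩
  have hqd : IsDirection q (b, a') := ⟨hab.symm, hq.2, by rwa [closedEdge_comm] at hqe⟩
  -- If the two extreme points coincide, both directions there are free and that one point needs two
  -- chips; otherwise each needs one.
  by_cases hpq : p = q
  · subst hpq
    have h1 := card_le_of_saturated hsat hpX (T := {(a', b), (b, a')}) (by simp) fun e he => by
      rcases Finset.mem_insert.1 he with rfl | he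
      · exact ⟨hpd, hpf⟩
      · rw [Finset.mem_singleton.1 he]
        exact ⟨hqd, hqf⟩
    rw [Finset.card_pair (by simp [hab])] at h1
    have h2 := degOn_mono (D := D) (singleton_subset_iff.2 hpo) (hD a' b hab)
    rw [degOn_singleton] at h2
    exact h1.trans h2
  · have h1 := card_le_of_saturated hsat hpX (T := {(a', b)}) (by simp) fun e he => by
      rw [Finset.mem_singleton.1 he]
      exact ⟨hpd, hpf⟩
    have h2 := card_le_of_saturated hsat hqX (T := {(b, a')}) (by simp) fun e he => by
      rw [Finset.mem_singleton.1 he]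
      exact ⟨hqd, hqf⟩
    have h3 := degOn_mono (D := D) (S := {p} ∪ {q})
      (union_subset (singleton_subset_iff.2 hpo) (singleton_subset_iff.2 hqo)) (hD a' b hab)
    rw [degOn_union D (by simpa using hpq), degOn_singleton, degOn_singleton] at h3
    simp only [Finset.card_singleton, Nat.cast_one] at h1 h2
    linarith

/-! ### Segments inside an edge, and condition 2 -/

/-- The part of the edge joining `a` and `b` where the weight of `b` lies in `[s, t]` is
connected. -/
theorem isPreconnected_edge_Icc {a b : Fin d} (hab : a ≠ b) (s t : ℝ) :
    IsPreconnected {p | p ∈ closedEdge a b ∧ s ≤ p.1 b ∧ p.1 b ≤ t} := by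
  have : {p | p ∈ closedEdge a b ∧ s ≤ p.1 b ∧ p.1 b ≤ t} =
      edgePoint a b '' ((↑) ⁻¹' Icc s t) := by
    ext p
    constructor
    · rintro ⟨hp, hs, ht⟩
      exact ⟨coordI p b, ⟨hs, ht⟩, edgePoint_coordI hab hp⟩
    · rintro ⟨x, hx, rfl⟩
      refine ⟨edgePoint_mem_closedEdge a b x, ?_⟩
      rw [edgePoint_coord_right hab]
      exact hx
  rw [this]
  refine IsPreconnected.image ?_ _ (continuous_edgePoint a b).continuousOn
  refine Set.OrdConnected.isPreconnected ?_
  exact (ordConnected_Icc (a := s) (b := t)).preimage_mono (Subtype.mono_coe _)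

theorem isClosed_closedEdge (a b : Fin d) : IsClosed (closedEdge a b) := by
  have : closedEdge a b = ⋂ (c : Fin d) (_ : c ≠ a ∧ c ≠ b), {p | p.1 c = 0} := by
    ext p
    simp only [mem_iInter, mem_ofPred_eq]
    constructor
    · exact fun hp c hc => coord_eq_zero hp hc.1 hc.2
    · intro h c hc
      by_contra hcab
      simp only [mem_insert_iff, mem_singleton_iff, not_or] at hcab
      exact hc (h c hcab)
  rw [this]
  exact isClosed_iInter fun c => isClosed_iInter fun _ =>
    isClosed_eq (continuous_coord c) continuous_const

theorem isClosed_edge_Icc (a b : Fin d) (s t : ℝ) :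
    IsClosed {p | p ∈ closedEdge a b ∧ s ≤ p.1 b ∧ p.1 b ≤ t} :=
  (isClosed_closedEdge a b).inter ((isClosed_le continuous_const (continuous_coord b)).inter
    (isClosed_le (continuous_coord b) continuous_const))

/-- The segment between two points of an open edge is saturated as soon as its ends carry enough
chips. -/
theorem not_isReduced_of_segment {v : Fin d} {D : Divisor (CompleteMetricGraph d)}
    {a b : Fin d} (hab : a ≠ b) (hD : ∀ p ∈ openEdge a b, 0 ≤ D p)
    {x y : CompleteMetricGraph d} (hx : x ∈ openEdge a b) (hy : y ∈ openEdge a b)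
    (hxy : x.1 b ≤ y.1 b) (hDx : 1 ≤ D x) (hDy : 1 ≤ D y) (h2 : x = y → 2 ≤ D x) :
    ¬ IsReduced D (vertex v) := by
  classical
  rintro ⟨-, hred⟩
  have hx' := (mem_openEdge hab).1 hx
  have hy' := (mem_openEdge hab).1 hy
  have hxe := mem_closedEdge_of_pos hab hx'.1 hx'.2
  have hye := mem_closedEdge_of_pos hab hy'.1 hy'.2
  have hx1 := add_eq_one hab hxe
  have hy1 := add_eq_one hab hye
  set X := {p | p ∈ closedEdge a b ∧ x.1 b ≤ p.1 b ∧ p.1 b ≤ y.1 b} with hXdef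
  have hXo : X ⊆ openEdge a b := by
    rintro p ⟨hp, hp1, hp2⟩
    have := add_eq_one hab hp
    exact (mem_openEdge hab).2 ⟨by linarith, by linarith⟩
  obtain ⟨q, hq, hns⟩ := hred X (isClosed_edge_Icc a b _ _)
    ⟨⟨x, hxe, le_rfl, hxy⟩, isPreconnected_edge_Icc hab _ _⟩
    fun h => ne_vertex_of_mem_openEdge hab (hXo h) v rfl
  have hqX : q ∈ X := (isClosed_edge_Icc a b _ _).frontier_subset hq
  have hqo := hXo hqX
  have hq' := (mem_openEdge hab).1 hqo
  have hq1 := add_eq_one hab hqX.1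
  refine hns ?_
  -- The ways out of the segment at `q`: one at each end, both if the segment is a single point,
  -- none in between.
  set T : Finset (Fin d × Fin d) := (if q.1 b = y.1 b then {(a, b)} else ∅) ∪
    (if q.1 b = x.1 b then {(b, a)} else ∅) with hT
  have hTD : (T.card : ℤ) ≤ D q := by
    have hqy : q.1 b = y.1 b → q = y := closedEdge_ext hab hqX.1 hye
    have hqx : q.1 b = x.1 b → q = x := closedEdge_ext hab hqX.1 hxe
    by_cases h1 : q.1 b = y.1 b <;> by_cases h3 : q.1 b = x.1 b
    · rw [hT, if_pos h1, if_pos h3]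
      have : (({(a, b)} ∪ {(b, a)} : Finset (Fin d × Fin d)).card : ℤ) ≤ 2 := by
        exact_mod_cast Finset.card_union_le _ _
      rw [hqx h3]
      exact this.trans (h2 ((hqx h3).symm.trans (hqy h1)))
    · rw [hT, if_pos h1, if_neg h3, hqy h1]
      simpa using hDy
    · rw [hT, if_neg h1, if_pos h3, hqx h3]
      simpa using hDx
    · simpa [hT, h1, h3] using hD q hqo
  refine le_trans (Int.ofNat_le.2 (outdeg_le T ?_ (N := {z | (0 < z.1 a ∧ 0 < z.1 b) ∧
    (q.1 b < y.1 b → z.1 b < y.1 b) ∧ (x.1 b < q.1 b → x.1 b < z.1 b)}) ?_ ?_)) hTD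
  · intro e he
    rw [hT, Finset.mem_union] at he
    rcases he with he | he
    · split_ifs at he
      · rw [Finset.mem_singleton.1 he]
        exact ⟨hab, hq'.1, hqX.1⟩
      · simp at he
    · split_ifs at he
      · rw [Finset.mem_singleton.1 he]
        exact ⟨hab.symm, hq'.2, by rw [closedEdge_comm]; exact hqX.1⟩
      · simp at he
  · have hc := continuous_coord (d := d)
    refine Filter.inter_mem (Filter.inter_mem ((isOpen_lt continuous_const (hc a)).mem_nhds hq'.1)
      ((isOpen_lt continuous_const (hc b)).mem_nhds hq'.2)) (Filter.inter_mem ?_ ?_)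
    · by_cases h : q.1 b < y.1 b
      · filter_upwards [(isOpen_lt (hc b) continuous_const).mem_nhds h] with z hz _ using hz
      · exact Filter.Eventually.of_forall fun z hz => absurd hz h
    · by_cases h : x.1 b < q.1 b
      · filter_upwards [(isOpen_lt continuous_const (hc b)).mem_nhds h] with z hz _ using hz
      · exact Filter.Eventually.of_forall fun z hz => absurd hz h
  · rintro z ⟨⟨hza, hzb⟩, hzy, hzx⟩ hzX -
    have hze := mem_closedEdge_of_pos hab hza hzb
    have hz1 := add_eq_one hab hze
    rcases lt_or_ge (z.1 b) (x.1 b) with h | h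
    · have hqx : q.1 b = x.1 b := le_antisymm (not_lt.1 fun h' => by linarith [hzx h']) hqX.2.1
      refine ⟨(b, a), by simp [hT, hqx], hzb, ?_⟩
      change q.1 a < z.1 a
      linarith
    · have h' : y.1 b < z.1 b := not_le.1 fun h' => hzX ⟨hze, h, h'⟩
      have hqy : q.1 b = y.1 b := le_antisymm hqX.2.2 (not_lt.1 fun h'' => by linarith [hzy h''])
      exact ⟨(a, b), by simp [hT, hqy], hza, by change q.1 b < z.1 b; linarith⟩

/-- Degree at least 2 means either one point with two chips or two distinct points with a chip each;
in both cases the segment they span is saturated. -/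
theorem degOn_openEdge_le_one {v : Fin d} {D : Divisor (CompleteMetricGraph d)}
    (hred : IsReduced D (vertex v)) {a b : Fin d} (hab : a ≠ b) :
    degOn D (openEdge a b) ≤ 1 := by
  by_contra! hdeg
  have hD : ∀ p ∈ openEdge a b, 0 ≤ D p := fun p hp =>
    hred.1 p (ne_vertex_of_mem_openEdge hab hp v)
  obtain ⟨x, hx, hDx⟩ := exists_pos_of_degOn_pos (by linarith : 0 < degOn D (openEdge a b))
  by_cases hx2 : 2 ≤ D x
  · exact not_isReduced_of_segment hab hD hx hx le_rfl hDx hDx (fun _ => hx2) hred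
  · have hsplit : degOn D (openEdge a b) = D x + degOn D (openEdge a b \ {x}) := by
      rw [← degOn_singleton D x, ← degOn_union D disjoint_sdiff_right,
        union_sdiff_cancel (singleton_subset_iff.2 hx)]
    obtain ⟨y, hy, hDy⟩ := exists_pos_of_degOn_pos
      (by linarith : 0 < degOn D (openEdge a b \ {x}))
    have hyx : y ≠ x := hy.2
    rcases le_total (x.1 b) (y.1 b) with h | h
    · exact not_isReduced_of_segment hab hD hx hy.1 h hDx hDy (fun h => absurd h.symm hyx) hred
    · exact not_isReduced_of_segment hab hD hy.1 hx h hDy hDx (fun h => absurd h hyx) hred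

/-! ### The unburnt region and the burning step -/

/-- The initial part of the edge from `u` to `w`, up to the point where the weight of `w`
is `t`. -/
def initialSegment (u w : Fin d) (t : ℝ) : Set (CompleteMetricGraph d) :=
  {p | p ∈ closedEdge u w ∧ 0 ≤ p.1 w ∧ p.1 w ≤ t}

theorem vertex_mem_initialSegment {u w : Fin d} (h : w ≠ u) {t : ℝ} (ht : 0 ≤ t) :
    vertex u ∈ initialSegment u w t := by
  refine ⟨vertex_mem_closedEdge u w, ?_⟩
  rw [vertex_coord_of_ne h]
  exact ⟨le_rfl, ht⟩

/-- The union of the initial segments of length `c u w` of all edges from a vertex `u` outside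
`B` to any other vertex `w`. -/
def unburnt (B : Finset (Fin d)) (c : Fin d → Fin d → ℝ) : Set (CompleteMetricGraph d) :=
  ⋃ (u : Fin d) (_ : u ∉ B) (w : Fin d) (_ : w ≠ u), initialSegment u w (c u w)

theorem mem_unburnt {B : Finset (Fin d)} {c : Fin d → Fin d → ℝ} {p : CompleteMetricGraph d} :
    p ∈ unburnt B c ↔ ∃ u ∉ B, ∃ w, w ≠ u ∧ p ∈ initialSegment u w (c u w) := by
  simp only [unburnt, mem_iUnion, exists_prop]

theorem isClosed_unburnt (B : Finset (Fin d)) (c : Fin d → Fin d → ℝ) :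
    IsClosed (unburnt B c) :=
  isClosed_iUnion_of_finite fun _ => isClosed_iUnion_of_finite fun _ =>
    isClosed_iUnion_of_finite fun _ => isClosed_iUnion_of_finite fun _ => isClosed_edge_Icc _ _ _ _

/-- Edges between unburnt vertices are contained entirely (cutoff 1), so every initial segment is
linked to `u₀` through its starting vertex. -/
theorem isPreconnected_unburnt {B : Finset (Fin d)} {c : Fin d → Fin d → ℝ}
    (hc0 : ∀ u ∉ B, ∀ w, 0 ≤ c u w) (hc1 : ∀ u ∉ B, ∀ w ∉ B, c u w = 1)
    (hB : B.Nonempty) {u₀ : Fin d} (hu₀ : u₀ ∉ B) :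
    IsPreconnected (unburnt B c) := by
  obtain ⟨b, hb⟩ := hB
  have hsub : ∀ u ∉ B, ∀ w, w ≠ u → initialSegment u w (c u w) ⊆ unburnt B c :=
    fun u hu w hw p hp => mem_unburnt.2 ⟨u, hu, w, hw, hp⟩
  have hpre : ∀ u w : Fin d, w ≠ u → IsPreconnected (initialSegment u w (c u w)) :=
    fun u w hw => isPreconnected_edge_Icc hw.symm _ _
  refine isPreconnected_of_forall (vertex u₀) fun p hp => ?_
  obtain ⟨u, hu, w, hw, hpw⟩ := mem_unburnt.1 hp
  by_cases h : u = u₀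
  · subst h
    exact ⟨_, hsub u hu w hw, vertex_mem_initialSegment hw (hc0 u hu w), hpw, hpre u w hw⟩
  · refine ⟨_, union_subset (hsub u₀ hu₀ u h) (hsub u hu w hw),
      Or.inl (vertex_mem_initialSegment h (hc0 u₀ hu₀ u)), Or.inr hpw,
      IsPreconnected.union (vertex u) ?_ (vertex_mem_initialSegment hw (hc0 u hu w))
        (hpre u₀ u h) (hpre u w hw)⟩
    refine ⟨by rw [closedEdge_comm]; exact vertex_mem_closedEdge u u₀, ?_⟩
    rw [vertex_coord_self, hc1 u₀ hu₀ u hu]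
    exact ⟨zero_le_one, le_rfl⟩

theorem vertex_notMem_unburnt {B : Finset (Fin d)} {c : Fin d → Fin d → ℝ}
    (hcB : ∀ u ∉ B, ∀ w ∈ B, c u w < 1) {v : Fin d} (hv : v ∈ B) :
    vertex v ∉ unburnt B c := by
  intro h
  obtain ⟨u, hu, w, hw, hp, -, hpw⟩ := mem_unburnt.1 h
  have hvu : v ≠ u := fun h => hu (h ▸ hv)
  by_cases hvw : v = w
  · subst hvw
    rw [vertex_coord_self] at hpw
    linarith [hcB u hu v hv]
  · have := coord_eq_zero hp hvu hvw
    rw [vertex_coord_self] at this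
    exact one_ne_zero this

/-- The last two hypotheses say that `z` is near `q`: supports do not shrink, and no cutoff strictly
ahead of `q` is reached. Leaving the region thus means crossing a cutoff located at `q`, necessarily
towards a burnt vertex. -/
theorem exists_direction_of_notMem_unburnt {B : Finset (Fin d)} {c : Fin d → Fin d → ℝ}
    (hc0 : ∀ u ∉ B, ∀ w, 0 ≤ c u w) (hc1 : ∀ u ∉ B, ∀ w ∉ B, c u w = 1)
    (hcB : ∀ u ∉ B, ∀ w ∈ B, c u w < 1) (hB : B.Nonempty)
    {q z : CompleteMetricGraph d} (hq : q ∈ unburnt B c) (hz : z ∉ unburnt B c)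
    (hzq : ∀ a, 0 < q.1 a → 0 < z.1 a) (hzc : ∀ u b, q.1 b < c u b → z.1 b < c u b) :
    ∃ u ∉ B, ∃ b ∈ B, IsDirection q (u, b) ∧ q.1 b = c u b ∧ z ∈ arm q (u, b) := by
  obtain ⟨b₀, hb₀⟩ := hB
  obtain ⟨u₀, hu₀, w₀, hw₀, hq₀, -, hqc⟩ := mem_unburnt.1 hq
  have hsum := add_eq_one hw₀.symm hq₀
  -- If `q` is the far end `w₀` of its segment, the cutoff there is at least 1, so `w₀` is itself
  -- unburnt and serves as `u`.
  obtain ⟨u, hu, hqu⟩ : ∃ u ∉ B, 0 < q.1 u := by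
    by_cases h : 0 < q.1 u₀
    · exact ⟨u₀, hu₀, h⟩
    · have h0 : q.1 u₀ = 0 := le_antisymm (not_lt.1 h) (coord_nonneg q u₀)
      exact ⟨w₀, fun hw => by linarith [hcB u₀ hu₀ w₀ hw], by linarith⟩
  -- If the edge found for `z` is degenerate, `z` is the vertex `u`, and `b₀` serves as the other
  -- end.
  obtain ⟨w, hzw, hwu⟩ : ∃ w, z ∈ closedEdge u w ∧ w ≠ u := by
    obtain ⟨w, hw⟩ := exists_mem_closedEdge (hzq u hqu)
    by_cases h : w = u
    · subst h
      exact ⟨b₀, fun x hx => Or.inl (by simpa using hw hx), fun h => hu (h ▸ hb₀)⟩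
    · exact ⟨w, hw, h⟩
  have hcz : c u w < z.1 w := not_le.1 fun h =>
    hz (mem_unburnt.2 ⟨u, hu, w, hwu, hzw, coord_nonneg z w, h⟩)
  have hzsum := add_eq_one hwu.symm hzw
  have hwB : w ∈ B := by
    by_contra h
    rw [hc1 u hu w h] at hcz
    linarith [coord_nonneg z u]
  have hqe : q ∈ closedEdge u w := fun a ha =>
    hzw (hzq a ((coord_nonneg q a).lt_of_ne' ha)).ne'
  have hge : c u w ≤ q.1 w := not_lt.1 fun h => by linarith [hzc u w h]
  have hle : q.1 w ≤ c u w := by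
    by_cases h : q.1 w = 0
    · rw [h]
      exact hc0 u hu w
    · have hww : w = w₀ := by
        rcases hq₀ h with h' | h'
        · exact absurd hwB (h' ▸ hu₀)
        · exact h'
      have huu : u = u₀ := by
        rcases hq₀ (show u ∈ Function.support q.1 from hqu.ne') with h' | h'
        · exact h'
        · exact absurd (hww.trans h'.symm) hwu
      rw [huu, hww]
      exact hqc
  have heq := le_antisymm hle hge
  exact ⟨u, hu, w, hwB, ⟨hwu.symm, hqu, hqe⟩, heq, hzq u hqu, by
    change q.1 w < z.1 w
    rwa [heq]⟩

/-- The ways out at an unburnt vertex `u` are its edges with cutoff 0, and at an interior cutoff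
there is one way out; `hvert` and `hedge` supply chips for these. -/
theorem not_isReduced_of_unburnt {D : Divisor (CompleteMetricGraph d)} {B : Finset (Fin d)}
    {c : Fin d → Fin d → ℝ} {v : Fin d} (hD : ∀ p, p ≠ vertex v → 0 ≤ D p)
    (hc0 : ∀ u ∉ B, ∀ w, 0 ≤ c u w) (hc1 : ∀ u ∉ B, ∀ w ∉ B, c u w = 1)
    (hcB : ∀ u ∉ B, ∀ w ∈ B, c u w < 1) (hv : v ∈ B) {u₀ : Fin d} (hu₀ : u₀ ∉ B)
    (hvert : ∀ u ∉ B, ((B.filter fun b => c u b = 0).card : ℤ) ≤ D (vertex u))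
    (hedge : ∀ u ∉ B, ∀ b ∈ B, ∀ q ∈ openEdge u b, q.1 b = c u b → 1 ≤ D q) :
    ¬ IsReduced D (vertex v) := by
  classical
  rintro ⟨-, hred⟩
  have hvX : vertex v ∉ unburnt B c := vertex_notMem_unburnt hcB hv
  have hvu : v ≠ u₀ := fun h => hu₀ (h ▸ hv)
  obtain ⟨q, hqf, hns⟩ := hred (unburnt B c) (isClosed_unburnt B c)
    ⟨⟨vertex u₀, mem_unburnt.2 ⟨u₀, hu₀, v, hvu,
      vertex_mem_initialSegment hvu (hc0 u₀ hu₀ v)⟩⟩,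
      isPreconnected_unburnt hc0 hc1 ⟨v, hv⟩ hu₀⟩ hvX
  have hq : q ∈ unburnt B c := (isClosed_unburnt B c).frontier_subset hqf
  refine hns ?_
  set T : Finset (Fin d × Fin d) := Finset.univ.filter fun e =>
    IsDirection q e ∧ e.1 ∉ B ∧ e.2 ∈ B ∧ q.1 e.2 = c e.1 e.2 with hT
  have hTmem : ∀ e, e ∈ T ↔ IsDirection q e ∧ e.1 ∉ B ∧ e.2 ∈ B ∧ q.1 e.2 = c e.1 e.2 := by
    simp [hT]
  have hTD : (T.card : ℤ) ≤ D q := by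
    rcases T.eq_empty_or_nonempty with h | ⟨⟨u, b⟩, he⟩
    · rw [h]
      exact hD q fun h => hvX (h ▸ hq)
    obtain ⟨hdir, hu, hb, hqc⟩ := (hTmem _).1 he
    have hub : u ≠ b := hdir.ne
    -- The support of `q` lies in `{u, b}` with `b` burnt, so all ways out at `q` start from the
    -- same unburnt vertex.
    have hfst : ∀ f ∈ T, f.1 = u := by
      intro f hf
      obtain ⟨hfd, hfu, -, -⟩ := (hTmem f).1 hf
      rcases hdir.mem (show f.1 ∈ Function.support q.1 from hfd.pos.ne') with h | h
      · exact h
      · exact absurd hb (show b ∉ B from (show f.1 = b from h) ▸ hfu)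
    by_cases hqb : q.1 b = 0
    · obtain rfl : q = vertex u := eq_vertex hub hdir.mem hqb
      refine le_trans (Int.ofNat_le.2 ?_) (hvert u hu)
      rw [← Finset.card_image_of_injective (B.filter fun b => c u b = 0)
        (Prod.mk_right_injective u)]
      refine Finset.card_le_card fun f hf => ?_
      obtain ⟨hfd, -, hfb, hfc⟩ := (hTmem f).1 hf
      have hfu := hfst f hf
      refine Finset.mem_image.2 ⟨f.2, Finset.mem_filter.2 ⟨hfb, ?_⟩, Prod.ext hfu.symm rfl⟩
      rw [← hfu, ← hfc, vertex_coord_of_ne]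
      rw [← hfu]
      exact hfd.ne.symm
    · have hqo : q ∈ openEdge u b :=
        (mem_openEdge hub).2 ⟨hdir.pos, (coord_nonneg q b).lt_of_ne' hqb⟩
      have hsub : T ⊆ {(u, b)} := by
        intro f hf
        obtain ⟨hfd, hfu, -, -⟩ := (hTmem f).1 hf
        refine Finset.mem_singleton.2 (Prod.ext (hfst f hf) ?_)
        rcases hfd.mem (show b ∈ Function.support q.1 from hqb) with h | h
        · exact absurd hb (h ▸ hfu)
        · exact (show b = f.2 from h).symm
      refine le_trans ?_ (hedge u hu b hb q hqo hqc)
      exact_mod_cast Finset.card_le_card hsub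
  refine le_trans (Int.ofNat_le.2 (outdeg_le T (fun e he => ((hTmem e).1 he).1)
    (N := {z | ∀ a, 0 < q.1 a → 0 < z.1 a} ∩ ⋂ (u : Fin d) (b : Fin d),
      {z | q.1 b < c u b → z.1 b < c u b}) ?_ ?_)) hTD
  · refine Filter.inter_mem (support_nhds q) ?_
    simp only [Filter.iInter_mem]
    intro u b
    by_cases h : q.1 b < c u b
    · filter_upwards [(isOpen_lt (continuous_coord b) continuous_const).mem_nhds h]
        with z hz _ using hz
    · exact Filter.Eventually.of_forall fun z hz => absurd hz h
  · rintro z ⟨hz1, hz2⟩ hzX -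
    simp only [mem_iInter] at hz2
    obtain ⟨u, hu, b, hb, hdir, hqc, harm⟩ :=
      exists_direction_of_notMem_unburnt hc0 hc1 hcB ⟨v, hv⟩ hq hzX hz1 hz2
    exact ⟨(u, b), (hTmem _).2 ⟨hdir, hu, hb, hqc⟩, harm⟩

/-- Dhar's burning step: if the fire has reached the vertices of `B`, then it reaches a further
vertex. -/
theorem exists_degOn_star_lt {v : Fin d} {D : Divisor (CompleteMetricGraph d)}
    (hred : IsReduced D (vertex v)) {B : Finset (Fin d)} (hv : v ∈ B) (hB : B ≠ Finset.univ) :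
    ∃ u, u ∉ B ∧ degOn D (⋃ b ∈ B, halfOpenEdge b u) < B.card := by
  classical
  by_contra! hcon
  obtain ⟨u₀, hu₀⟩ : ∃ u₀, u₀ ∉ B := by
    by_contra! h
    exact hB (Finset.eq_univ_iff_forall.2 h)
  have hne : ∀ u ∉ B, ∀ b ∈ B, u ≠ b := fun u hu b hb h => hu (h ▸ hb)
  -- The cutoff `t` is the position of a chip on the edge from `u` to a burnt `b`, or 0 if its
  -- interior has no positive degree. It is 1 towards unburnt vertices; for burnt `u` the value is
  -- irrelevant.
  have hchip : ∀ u b, ∃ t : ℝ, 0 ≤ t ∧ (b ∉ B → t = 1) ∧ (u ∉ B → b ∈ B → t < 1 ∧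
      ((t = 0 ∧ degOn D (openEdge b u) ≤ 0) ∨
        (t ≠ 0 ∧ ∀ q ∈ openEdge u b, q.1 b = t → 1 ≤ D q))) := by
    intro u b
    by_cases hb : b ∈ B
    swap
    · exact ⟨1, zero_le_one, fun _ => rfl, fun _ h => absurd h hb⟩
    by_cases hu : u ∈ B
    · exact ⟨1, zero_le_one, fun _ => rfl, fun h => absurd hu h⟩
    have hub := hne u hu b hb
    by_cases h : 0 < degOn D (openEdge b u)
    · obtain ⟨x, hx, hDx⟩ := exists_pos_of_degOn_pos h
      rw [mem_openEdge hub.symm] at hx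
      have hxe := mem_closedEdge_of_pos hub hx.2 hx.1
      have hsum := add_eq_one hub hxe
      refine ⟨x.1 b, hx.1.le, fun h => absurd hb h, fun _ _ => ⟨by linarith, Or.inr
        ⟨hx.1.ne', fun q hq hqx => ?_⟩⟩⟩
      have hq' := (mem_openEdge hub).1 hq
      rw [closedEdge_ext hub (mem_closedEdge_of_pos hub hq'.1 hq'.2) hxe hqx]
      exact hDx
    · exact ⟨0, le_rfl, fun h => absurd hb h, fun _ _ => ⟨zero_lt_one, Or.inl ⟨rfl, not_lt.1 h⟩⟩⟩
  choose c hc0 hc1 hcB using hchip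
  refine not_isReduced_of_unburnt hred.1 (fun u _ w => hc0 u w) (fun u _ w hw => hc1 u w hw)
    (fun u hu w hw => (hcB u w hu hw).1) hv hu₀ (fun u hu => ?_) (fun u hu b hb q hq hqc => ?_) hred
  · have h1 := hcon u hu
    rw [degOn_star D ⟨v, hv⟩ hu] at h1
    -- Summing over `B`, the edges carry at most `|B|` minus the number of zero cutoffs; as the star
    -- carries at least `|B|`, the vertex `u` has a chip for every zero cutoff.
    have h2 : ∀ b ∈ B, degOn D (openEdge b u) ≤ 1 - (if c u b = 0 then 1 else 0) := by
      intro b hb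
      rcases (hcB u b hu hb).2 with ⟨h, h'⟩ | ⟨h, -⟩
      · simpa [h] using h'
      · simpa [h] using degOn_openEdge_le_one hred (hne u hu b hb).symm
    have h3 := Finset.sum_le_sum h2
    rw [Finset.sum_sub_distrib, Finset.sum_boole] at h3
    simp only [Finset.sum_const, nsmul_eq_mul, mul_one] at h3
    linarith
  · rcases (hcB u b hu hb).2 with ⟨h, -⟩ | ⟨-, h⟩
    · rw [h] at hqc
      have := ((mem_openEdge (hne u hu b hb)).1 hq).2
      linarith
    · exact h q hq hqc

/-! ### Burning orders and the two implications -/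

/-- The set of vertices consisting of `v` and the members of `S`. -/
def burnt (v : Fin d) (S : Finset {w : Fin d // w ≠ v}) : Finset (Fin d) :=
  insert v (S.map (Function.Embedding.subtype _))

theorem self_mem_burnt (v : Fin d) (S : Finset {w : Fin d // w ≠ v}) : v ∈ burnt v S :=
  Finset.mem_insert_self _ _

theorem card_burnt (v : Fin d) (S : Finset {w : Fin d // w ≠ v}) :
    (burnt v S).card = S.card + 1 := by
  rw [burnt, Finset.card_insert_of_notMem, Finset.card_map]
  simp

theorem mem_burnt {v : Fin d} {S : Finset {w : Fin d // w ≠ v}} {w : {w : Fin d // w ≠ v}} :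
    w.1 ∈ burnt v S ↔ w ∈ S := by
  simp [burnt, w.2]

theorem orderedStar_eq (v : Fin d) (ord : Fin (d - 1) ≃ {w : Fin d // w ≠ v}) (i : Fin (d - 1)) :
    orderedStar v ord i =
      ⋃ b ∈ burnt v ((Finset.univ.filter (· < i)).image ord), halfOpenEdge b (ord i).1 := by
  rw [burnt, Finset.set_biUnion_insert, orderedStar]
  congr 1
  ext p
  simp

/-- Indices start at 0, so `i` vertices precede `ord i`, and `v` is one more. -/
theorem card_burnt_image (v : Fin d) (ord : Fin (d - 1) ≃ {w : Fin d // w ≠ v})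
    (i : Fin (d - 1)) :
    (burnt v ((Finset.univ.filter (· < i)).image ord)).card = (i : ℕ) + 1 := by
  have : Finset.univ.filter (· < i) = Finset.Iio i := by
    ext j
    simp
  rw [card_burnt, Finset.card_image_of_injective _ ord.injective, this, Fin.card_Iio]

theorem isReduced_of_burning {v : Fin d} {D : Divisor (CompleteMetricGraph d)}
    (hD : ∀ p, p ≠ vertex v → 0 ≤ D p)
    (hedge : ∀ a b : Fin d, a ≠ b → degOn D (openEdge a b) ≤ 1)
    (ord : Fin (d - 1) ≃ {w : Fin d // w ≠ v})
    (hord : ∀ i : Fin (d - 1), degOn D (orderedStar v ord i) ≤ ((i : ℕ) : ℤ)) :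
    IsReduced D (vertex v) := by
  refine ⟨hD, fun X hX hXc hvX => ?_⟩
  by_contra! hsat
  have hDo : ∀ a b, a ≠ b → ∀ p ∈ openEdge a b, 0 ≤ D p := fun a b hab p hp =>
    hD p (ne_vertex_of_mem_openEdge hab hp v)
  by_cases hvert : ∃ i, vertex (ord i).1 ∈ X
  · obtain ⟨i, hi, hmin⟩ := wellFounded_lt.has_min {i | vertex (ord i).1 ∈ X} hvert
    have hBX : ∀ b ∈ burnt v ((Finset.univ.filter (· < i)).image ord), vertex b ∉ X := by
      intro b hb hbX
      rcases eq_or_ne b v with rfl | hbv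
      · exact hvX hbX
      · have hb' := mem_burnt (w := ⟨b, hbv⟩).1 hb
        obtain ⟨j, hj, hjb⟩ := Finset.mem_image.1 hb'
        refine hmin j ?_ (Finset.mem_filter.1 hj).2
        change vertex (ord j).1 ∈ X
        rwa [hjb]
    have h1 := card_le_degOn_star hX hsat ⟨v, self_mem_burnt v _⟩ hi hBX
      (hD _ fun h => hvX (h ▸ hi)) fun b hb =>
        hDo b (ord i).1 fun h => hBX b hb (by rw [h]; exact hi)
    rw [← orderedStar_eq, card_burnt_image] at h1
    have h2 := hord i
    push_cast at h1
    omega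
  · obtain ⟨a, b, hab, h⟩ := exists_two_le_degOn_openEdge hX hXc.nonempty hsat (fun a ha => by
      rcases eq_or_ne a v with rfl | hav
      · exact hvX ha
      · exact hvert ⟨ord.symm ⟨a, hav⟩, by simpa using ha⟩) hDo
    linarith [hedge a b hab]

/-- Letting the fire spread one vertex at a time gives the ordering; a star degree below `i + 1` is
one of at most `i`. -/
theorem exists_burning_order {v : Fin d} {D : Divisor (CompleteMetricGraph d)}
    (hred : IsReduced D (vertex v)) :
    ∃ ord : Fin (d - 1) ≃ {w : Fin d // w ≠ v}, ∀ i : Fin (d - 1),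
      degOn D (orderedStar v ord i) ≤ ((i : ℕ) : ℤ) := by
  obtain ⟨ord, hord⟩ := exists_greedy_equiv (α := {w : Fin d // w ≠ v}) (n := d - 1) (by simp)
    (fun S u => degOn D (⋃ b ∈ burnt v S, halfOpenEdge b u.1) < (burnt v S).card)
    fun S hS => by
      obtain ⟨u, hu, hdeg⟩ := exists_degOn_star_lt hred (B := burnt v S)
        (self_mem_burnt v S) fun h => hS (Finset.eq_univ_iff_forall.2 fun w =>
          mem_burnt.1 (by rw [h]; exact Finset.mem_univ w.1))
      have huv : u ≠ v := fun h => hu (by rw [h]; exact self_mem_burnt v S)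
      exact ⟨⟨u, huv⟩, fun h => hu (mem_burnt (w := ⟨u, huv⟩).2 h), hdeg⟩
  refine ⟨ord, fun i => ?_⟩
  have h := hord i
  rw [← orderedStar_eq, card_burnt_image] at h
  push_cast at h
  omega

end CompleteMetricGraph

end

theorem mainTheorem6 (d : ℕ) (v : Fin d)
    (D : MetricGraph.Divisor (CompleteMetricGraph d)) :
    MetricGraph.IsReduced D (CompleteMetricGraph.vertex v) ↔
      (∀ p, p ≠ CompleteMetricGraph.vertex v → 0 ≤ D p) ∧
      (∀ a b : Fin d, a ≠ b → MetricGraph.degOn D (CompleteMetricGraph.openEdge a b) ≤ 1) ∧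
      ∃ ord : Fin (d - 1) ≃ {w : Fin d // w ≠ v}, ∀ i : Fin (d - 1),
        MetricGraph.degOn D (CompleteMetricGraph.orderedStar v ord i) ≤ ((i : ℕ) : ℤ) :=
  ⟨fun h => ⟨h.1, fun _ _ hab => CompleteMetricGraph.degOn_openEdge_le_one h hab,
    CompleteMetricGraph.exists_burning_order h⟩,
    fun ⟨hD, hedge, ord, hord⟩ => CompleteMetricGraph.isReduced_of_burning hD hedge ord hord⟩
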